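/- **Model.** There are $n$ nodes and $k$ messages, and $F_q$ is a finite field. Only the coefficient vectors of packets (elements of $F_q^k$) are tracked; a packet with coefficient vector $c$ also carries the linear combination $\sum_i c_i m_i$ of the messages. Initially each message is held by at least one node. A node that initially holds message $i$ keeps the packet $e_i$ as an active packet for ever; in addition every node $v$ has a memory for $s=1$ active packet $x_v$, initially $0$. In every round $t=0,1,2,\dots$ a fully adaptive adversary, knowing everything that happened in earlier rounds, chooses a directed graph $G(t)$ on the nodes; then every node $u$ independently draws a uniformly random vector $p_u$ from the span of its active packets and sends it to all its out-neighbours in $G(t)$; then every node $v$ updates its memory independently: in the *accumulator* scheme $x_v$ is replaced by $x_v$ plus a uniformly random linear combination of the packets just received by $v$; in the *recombinator* scheme (if at least one packet was received) $x_v$ is replaced by a uniformly random element of the span of $x_v$ and the packets just received. The protocol has *spread the messages* once, for every node, the coefficient vectors of its own initial packets and of all packets it has received span $F_q^k$ (so that it can decode). **Relaxed isoperimetry.** For a directed graph $G$ on $V$ and $S\subseteq V$ let $h_G(S)$ be the union of $S$ and the set of out-neighbours of $S$. For a real $H>0$ and an integer $\Delta\ge 1$, a dynamic graph $(G(t))_{t\ge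 0}$ on $V$ has relaxed isoperimetric number $H$ with window length $\Delta$ if for every $\emptyset\ne S\subsetneq V$ and every time $t$ $$\frac{\bigl|\bigcup_{i=t}^{t+\Delta-1}(h_{G(i)}\circ\dots\circ h_{G(t+1)}\circ h_{G(t)})(S)\bigr|-|S|}{\min(|\overline S|,|S|)\,\Delta}\ \ge\ H .$$ **Statement.** For every integer $\Delta\ge1$ there are constants $C>0$ and $q_0$, depending only on $\Delta$, such that the following holds for all $n$ and $k$, for every initial distribution of the messages, for every field size $q\ge\max(q_0,n^2)$, for both schemes, for every $H>0$, and for every adaptive adversary such that in every possible run the resulting dynamic graph has relaxed isoperimetric number $H$ with window length $\Delta$. Put $$B=\frac{\max(1,\log(nH))}{H}+k .$$ Then with probability at least $1-q^{-B}$ the synchronous broadcast FM-RLNC protocol with $s=1$ has spread all $k$ messages within at most $C\cdot B$ rounds. In particular, whenever $nH\ge 2$, it takes with high probability at most $O\bigl(\frac{\log (nH)}{H}+k\bigr)$ rounds. -/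

import Mathlib

noncomputable section

namespace FMRLNC

/-! ### Relaxed isoperimetry of dynamic graphs -/

section Isoperimetry

variable {V : Type*}

/-- `h_G(S)`: the union of `S` and its out-neighbourhood. (An undirected graph is a `Digraph`
with symmetric adjacency.) -/
def closedNbhd (G : Digraph V) (S : Set V) : Set V :=
  S ∪ {v | ∃ u ∈ S, G.Adj u v}

/-- `iterNbhd G t j S = (h_{G(t+j)} ∘ ⋯ ∘ h_{G(t+1)} ∘ h_{G(t)}) S`. -/
def iterNbhd (G : ℕ → Digraph V) (t : ℕ) : ℕ → Set V → Set V
  | 0, S => closedNbhd (G t) S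
  | j + 1, S => closedNbhd (G (t + (j + 1))) (iterNbhd G t j S)

/-- The dynamic graph `G` has relaxed isoperimetric number (at least) `H` with window length `Δ`.
For `S = univ` the quotient would be `0 / 0`, so `S` ranges over the non-empty proper subsets. -/
def HasRelaxedIsoperimetricNumber (G : ℕ → Digraph V) (Δ : ℕ) (H : ℝ) : Prop :=
  ∀ S : Set V, S.Nonempty → S ≠ Set.univ → ∀ t : ℕ,
    H ≤ (((⋃ j ∈ Finset.range Δ, iterNbhd G t j S).ncard : ℝ) - (S.ncard : ℝ)) /
      (min (Sᶜ.ncard : ℝ) (S.ncard : ℝ) * (Δ : ℝ))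

end Isoperimetry

/-! ### Elementary probability -/

/-- The probability of the event `E` under the discrete distribution `p`. -/
def prob {α : Type*} (p : PMF α) (E : Set α) : ℝ := (p.toOuterMeasure E).toReal

/-- Independent choices: for every `v` an element of the non-empty set `A v`, uniformly at random
(the uniform distribution on the product set). -/
def uniformPi {V W : Type*} [Finite V] [Finite W] (A : V → Set W) (hA : ∀ v, (A v).Nonempty) :
    PMF (V → W) :=
  PMF.uniformOfFinset (Set.toFinite (Set.univ.pi A)).toFinset
    ((Set.Finite.toFinset_nonempty _).2 (Set.univ_pi_nonempty_iff.2 hA))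

/-! ### The protocol -/

/-- The two finite memory schemes. -/
inductive Scheme
  | accumulator
  | recombinator

/-- What happens in one round: `sent v` is the (coefficient vector of the) packet broadcast by `v`,
`stored v` is the content of the one-packet memory of `v` at the end of the round. -/
structure Round (V F : Type*) (k : ℕ) where
  sent : V → Fin k → F
  stored : V → Fin k → F

/-- The complete history of a run, most recent round first. -/
abbrev History (V F : Type*) (k : ℕ) := List (Round V F k)

/-- A fully adaptive adversary: it chooses the topology of the next round as a function of
everything that happened before that round. -/
abbrev Adversary (V F : Type*) (k : ℕ) := History V F k → Digraph V

section Protocol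

variable {V F : Type*} [Field F] {k : ℕ}

/-- The current memory content (`s = 1` packet per node); it is the zero packet at the start. -/
def memory : History V F k → V → Fin k → F
  | [], _ => 0
  | r :: _, v => r.stored v

/-- The packets `e_i` of the messages `i ∈ M` that a node has from the start. -/
def ownPackets (F : Type*) [Field F] {k : ℕ} (M : Set (Fin k)) : Set (Fin k → F) :=
  {c | ∃ i ∈ M, c = Pi.single i 1}

/-- The span of the active packets of a node that initially holds the messages in `M` (and keeps
their packets unchanged) and has `x` in its memory. -/
def activeSpan (M : Set (Fin k)) (x : Fin k → F) : Submodule F (Fin k → F) :=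
  Submodule.span F (insert x (ownPackets F M))

/-- The packets that reach `v` if each node `u` broadcasts `p u` in the topology `G`. -/
def incoming (G : Digraph V) (p : V → Fin k → F) (v : V) : Set (Fin k → F) :=
  {c | ∃ u, G.Adj u v ∧ c = p u}

/-- The set on which the new memory content is uniformly distributed if the old content is `x` and
the set `P` of packets is received. The accumulator adds a uniformly random linear combination of
the received packets to `x`, i.e. a uniform element of their span. The recombinator takes a
uniform sample from the span of `x` and the received packets (and does nothing if no packet is
received). -/
def updateSet : Scheme → (Fin k → F) → Set (Fin k → F) → Set (Fin k → F)
  | .accumulator, x, P => {y | y - x ∈ Submodule.span F P}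
  | .recombinator, x, P => {y | (P = ∅ → y = x) ∧ y ∈ Submodule.span F (insert x P)}

theorem updateSet_nonempty (σ : Scheme) (x : Fin k → F) (P : Set (Fin k → F)) :
    (updateSet σ x P).Nonempty := by
  refine ⟨x, ?_⟩
  cases σ
  · simp [updateSet]
  · exact ⟨fun _ => rfl, Submodule.subset_span (Set.mem_insert _ _)⟩

theorem activeSpan_nonempty (M : Set (Fin k)) (x : Fin k → F) :
    (activeSpan M x : Set (Fin k → F)).Nonempty :=
  ⟨0, (activeSpan M x).zero_mem⟩

/-- One synchronous broadcast round after the history `h`: the adversary fixes the topology `adv h`;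
then every node independently draws a uniformly random packet from the span of its active packets
and broadcasts it; then every node independently updates its memory. `src v` is the set of messages
that `v` holds initially. -/
def step [Finite V] [Finite F] (σ : Scheme) (src : V → Set (Fin k)) (adv : Adversary V F k)
    (h : History V F k) : PMF (Round V F k) :=
  (uniformPi (fun v => (activeSpan (src v) (memory h v) : Set (Fin k → F)))
      (fun v => activeSpan_nonempty (src v) (memory h v))).bind fun p =>
    (uniformPi (fun v => updateSet σ (memory h v) (incoming (adv h) p v))
      (fun v => updateSet_nonempty σ (memory h v) (incoming (adv h) p v))).map fun y => ⟨p, y⟩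

/-- The distribution of the history after `t` rounds. -/
def run [Finite V] [Finite F] (σ : Scheme) (src : V → Set (Fin k)) (adv : Adversary V F k) :
    ℕ → PMF (History V F k)
  | 0 => PMF.pure []
  | t + 1 => (run σ src adv t).bind fun h => (step σ src adv h).map fun r => r :: h

/-- All packets that `v` has received during the history. -/
def received (adv : Adversary V F k) : History V F k → V → Set (Fin k → F)
  | [], _ => ∅
  | r :: h, v => received adv h v ∪ incoming (adv h) r.sent v

/-- `v` can decode: the coefficient vectors of its own initial packets and of all the packets it
has received span the whole space. -/
def CanDecode (src : V → Set (Fin k)) (adv : Adversary V F k) (h : History V F k) (v : V) : Prop :=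
  Submodule.span F (ownPackets F (src v) ∪ received adv h v) = ⊤

/-- The history consisting of the first `t` rounds of an infinite sequence of rounds. -/
def historyOf (ω : ℕ → Round V F k) : ℕ → History V F k
  | 0 => []
  | t + 1 => ω t :: historyOf ω t

/-- In every possible run against the adversary `adv` (one all of whose finite prefixes have
positive probability), the dynamic graph that arises has relaxed isoperimetric number (at least)
`H` with window length `Δ`. -/
def GuaranteesIsoperimetry [Finite V] [Finite F] (σ : Scheme) (src : V → Set (Fin k))
    (adv : Adversary V F k) (Δ : ℕ) (H : ℝ) : Prop :=
  ∀ ω : ℕ → Round V F k, (∀ t, historyOf ω t ∈ (run σ src adv t).support) →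
    HasRelaxedIsoperimetricNumber (fun t => adv (historyOf ω t)) Δ H

end Protocol

end FMRLNC

end

open scoped ENNReal

namespace FMRLNC

/-! Fix a nonzero functional `φ`. A node that cannot decode has everything it knows in the kernel of
some such `φ`, so it suffices to treat each `φ` separately and take a union bound over at most `q ^
k` of them. Call a node aware if `φ` does not vanish on its active span. Awareness can fail to
expand along `closedNbhd`, or be lost, only at a fault: a random draw lands in the kernel although
its range is a union of lines on which `φ` is a bijection onto `F`. Given the past, this has
probability at most `1 / q` per draw, whatever the adversary does.

Deterministically (`windows_le_of_forall_ne_univ`), a fault-free window raises a potential of the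
number of aware nodes by `1 / 4`, each fault costs a bounded amount, and the potential is `O(L)`
with `L = max 1 (log (n * H)) / H`. Hence failure after `100 * Δ * B` rounds forces at least `16 *
B` faults.

Probabilistically (`expect_pow_totalFaults_le`), the moment of `√q ^ faults` grows by a factor at
most `8` per round because `n ≤ √q`. Markov's inequality then gives failure probability `8 ^ T / q ^
(8 * B)` for each `φ`, which absorbs the union bound once `q` is large in terms of `Δ`. -/

/-- The expectation of a non-negative function under a discrete distribution. -/
noncomputable def expect {α : Type*} (p : PMF α) (g : α → ℝ≥0∞) : ℝ≥0∞ := ∑' a, p a * g a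

/-! ### Expectations under discrete and uniform product distributions -/

section Expectation

variable {α β : Type*}

theorem expect_bind (p : PMF α) (f : α → PMF β) (g : β → ℝ≥0∞) :
    expect (p.bind f) g = expect p fun a => expect (f a) g := by
  simp only [expect, PMF.bind_apply, ← ENNReal.tsum_mul_right, ← ENNReal.tsum_mul_left]
  rw [ENNReal.tsum_comm]
  simp only [mul_assoc]

theorem expect_pure (a : α) (g : α → ℝ≥0∞) : expect (PMF.pure a) g = g a := by
  rw [expect, tsum_eq_single a]
  · simp
  · intro b hb
    simp [PMF.pure_apply, hb]

theorem expect_map (p : PMF α) (f : α → β) (g : β → ℝ≥0∞) :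
    expect (p.map f) g = expect p fun a => g (f a) := by
  rw [← PMF.bind_pure_comp, expect_bind]
  simp [expect_pure]

theorem expect_mono (p : PMF α) {g g' : α → ℝ≥0∞} (h : ∀ a, g a ≤ g' a) :
    expect p g ≤ expect p g' :=
  ENNReal.tsum_le_tsum fun a => mul_le_mul_right (h a) _

theorem expect_mul_const (p : PMF α) (g : α → ℝ≥0∞) (c : ℝ≥0∞) :
    expect p (fun a => g a * c) = expect p g * c := by
  simp only [expect, ← ENNReal.tsum_mul_right, mul_assoc]

theorem expect_const_mul (p : PMF α) (g : α → ℝ≥0∞) (c : ℝ≥0∞) :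
    expect p (fun a => c * g a) = c * expect p g := by
  simp only [mul_comm c, expect_mul_const]

/-- Markov's inequality, where the lower bound is needed on the support only. -/
theorem mul_toOuterMeasure_le_expect (p : PMF α) (g : α → ℝ≥0∞) (E : Set α) (c : ℝ≥0∞)
    (h : ∀ a ∈ p.support, a ∈ E → c ≤ g a) : c * p.toOuterMeasure E ≤ expect p g := by
  rw [PMF.toOuterMeasure_apply, ← ENNReal.tsum_mul_left]
  refine ENNReal.tsum_le_tsum fun a => ?_
  by_cases ha : a ∈ E
  · by_cases hp : a ∈ p.support
    · rw [Set.indicator_of_mem ha, mul_comm]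
      exact mul_le_mul_right (h a hp ha) _
    · simp [ha, (PMF.apply_eq_zero_iff p a).2 hp]
  · simp [ha]

theorem one_sub_le_prob (p : PMF α) (E : Set α) {x : ℝ} (hx : 0 ≤ x)
    (h : p.toOuterMeasure Eᶜ ≤ ENNReal.ofReal x) : 1 - x ≤ prob p E := by
  have h1 : (1 : ℝ≥0∞) ≤ p.toOuterMeasure E + ENNReal.ofReal x := by
    have hu : p.toOuterMeasure Set.univ = 1 :=
      (PMF.toOuterMeasure_apply_eq_one_iff p _).2 (Set.subset_univ _)
    rw [← hu, ← Set.union_compl_self E]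
    exact (MeasureTheory.measure_union_le _ _).trans (add_le_add_right h _)
  have hE : p.toOuterMeasure E ≠ ∞ := by
    refine ne_top_of_le_ne_top ENNReal.one_ne_top ?_
    calc p.toOuterMeasure E ≤ p.toOuterMeasure Set.univ :=
          MeasureTheory.measure_mono (Set.subset_univ _)
      _ = 1 := (PMF.toOuterMeasure_apply_eq_one_iff p _).2 (Set.subset_univ _)
  have h2 := ENNReal.toReal_mono (ENNReal.add_ne_top.2 ⟨hE, ENNReal.ofReal_ne_top⟩) h1
  rw [ENNReal.toReal_add hE ENNReal.ofReal_ne_top, ENNReal.toReal_ofReal hx,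
    ENNReal.toReal_one] at h2
  rw [prob]
  linarith

theorem expect_uniformOfFinset (s : Finset α) (hs : s.Nonempty) (g : α → ℝ≥0∞) :
    expect (PMF.uniformOfFinset s hs) g = (∑ a ∈ s, g a) * (s.card : ℝ≥0∞)⁻¹ := by
  rw [expect, tsum_eq_sum (s := s), Finset.sum_mul]
  · refine Finset.sum_congr rfl fun a ha => ?_
    rw [PMF.uniformOfFinset_apply_of_mem hs ha, mul_comm]
  · intro a ha
    rw [PMF.uniformOfFinset_apply_of_notMem hs ha, zero_mul]

/-- Independence of the coordinates: a sum of products over a product set factorises. -/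
theorem expect_uniformPi_prod {V W : Type*} [Fintype V] [Finite W] (A : V → Set W)
    (hA : ∀ v, (A v).Nonempty) (g : V → W → ℝ≥0∞) :
    expect (uniformPi A hA) (fun y => ∏ v, g v (y v)) =
      ∏ v, ((∑ w ∈ (A v).toFinite.toFinset, g v w) * ((A v).ncard : ℝ≥0∞)⁻¹) := by
  classical
  have hfin : (Set.toFinite (Set.univ.pi A)).toFinset =
      Fintype.piFinset fun v => (A v).toFinite.toFinset := by
    ext y; simp
  rw [uniformPi, expect_uniformOfFinset, hfin, Finset.prod_mul_distrib,
    Finset.prod_univ_sum, Fintype.card_piFinset, Nat.cast_prod]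
  congr 1
  rw [ENNReal.prod_inv_distrib]
  · refine Finset.prod_congr rfl fun v _ => ?_
    rw [Set.ncard_eq_toFinset_card _ (A v).toFinite]
  · intro i _ j _ _
    exact Or.inr (ENNReal.natCast_ne_top _)

theorem mem_of_mem_support_uniformPi {V W : Type*} [Finite V] [Finite W] {A : V → Set W}
    {hA : ∀ v, (A v).Nonempty} {y : V → W} (hy : y ∈ (uniformPi A hA).support) (v : V) :
    y v ∈ A v := by
  rw [uniformPi, PMF.mem_support_uniformOfFinset_iff] at hy
  simp only [Set.Finite.mem_toFinset, Set.mem_univ_pi] at hy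
  exact hy v

end Expectation

/-! ### Faults -/

section Fault

variable {F W : Type*} [Field F] [AddCommGroup W] [Module F W]

/-- The set `A` is invariant under translation along a line on which `φ` does not vanish. -/
def Mixing (φ : Module.Dual F W) (A : Set W) : Prop :=
  ∃ u, φ u ≠ 0 ∧ ∀ y ∈ A, ∀ c : F, y + c • u ∈ A

/-- The number of nodes `v` for which `φ` happens to vanish at `y v` although it is equidistributed
on `A v`. -/
noncomputable def faultCount {V : Type*} (φ : Module.Dual F W) (A : V → Set W) (y : V → W) : ℕ :=
  {v | Mixing φ (A v) ∧ φ (y v) = 0}.ncard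

/-- The translates of the zero set by the multiples of `u` lie in `A` and are disjoint, since `φ (y
+ c • u) = c * φ u` recovers `c`. -/
theorem Mixing.ncard_zero_mul_card_le [Fintype F] [Finite W] {φ : Module.Dual F W} {A : Set W}
    (h : Mixing φ A) : {y | y ∈ A ∧ φ y = 0}.ncard * Fintype.card F ≤ A.ncard := by
  obtain ⟨u, hu, hA⟩ := h
  rw [← Nat.card_eq_fintype_card, ← Nat.card_coe_set_eq, ← Nat.card_coe_set_eq, ← Nat.card_prod]
  refine Nat.card_le_card_of_injective
    (fun x : {y | y ∈ A ∧ φ y = 0} × F => (⟨x.1.1 + x.2 • u, hA _ x.1.2.1 _⟩ : A)) ?_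
  rintro ⟨⟨y, hy, hy0⟩, c⟩ ⟨⟨z, hz, hz0⟩, d⟩ hxy
  have h1 : y + c • u = z + d • u := congrArg Subtype.val hxy
  have h2 : c = d := by
    have := congrArg φ h1
    simpa [hy0, hz0, hu] using this
  subst h2
  simpa using h1

theorem Mixing.sum_le [Fintype F] [Finite W] {φ : Module.Dual F W} {A : Set W}
    (hA : A.Nonempty) [DecidablePred fun y => Mixing φ A ∧ φ y = 0] (l : ℝ≥0∞) :
    (∑ y ∈ A.toFinite.toFinset, if Mixing φ A ∧ φ y = 0 then l else 1) * (A.ncard : ℝ≥0∞)⁻¹ ≤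
      1 + l * (Fintype.card F : ℝ≥0∞)⁻¹ := by
  classical
  have hc : (A.ncard : ℝ≥0∞) ≠ 0 := by
    simpa using (Set.ncard_pos A.toFinite).2 hA |>.ne'
  have hq : (Fintype.card F : ℝ≥0∞) ≠ 0 := by simp
  rw [← div_eq_mul_inv, ENNReal.div_le_iff hc (ENNReal.natCast_ne_top _)]
  by_cases hM : Mixing φ A
  · have hle : ∀ y, (if Mixing φ A ∧ φ y = 0 then l else 1) ≤ 1 + if φ y = 0 then l else 0 := by
      intro y
      by_cases hy : φ y = 0 <;> simp [hM, hy]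
    refine (Finset.sum_le_sum fun y _ => hle y).trans ?_
    rw [Finset.sum_add_distrib, ← Finset.sum_filter, Finset.sum_const, Finset.sum_const, add_mul,
      ← Set.ncard_eq_toFinset_card _ A.toFinite]
    have hz : ((A.toFinite.toFinset.filter fun y => φ y = 0).card : ℝ≥0∞) ≤
        (Fintype.card F : ℝ≥0∞)⁻¹ * A.ncard := by
      rw [mul_comm, ← div_eq_mul_inv, ENNReal.le_div_iff_mul_le (Or.inl hq)
        (Or.inl (ENNReal.natCast_ne_top _))]
      have := hM.ncard_zero_mul_card_le
      rw [Set.ncard_eq_toFinset_card _ (Set.toFinite _)] at this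
      have he : (Set.toFinite {y | y ∈ A ∧ φ y = 0}).toFinset =
          A.toFinite.toFinset.filter fun y => φ y = 0 := by ext; simp
      rw [he] at this
      exact_mod_cast this
    simp only [nsmul_eq_mul, mul_one, one_mul]
    refine add_le_add le_rfl ?_
    calc _ ≤ (Fintype.card F : ℝ≥0∞)⁻¹ * A.ncard * l := mul_le_mul_left hz l
      _ = _ := by ring
  · simp only [hM, false_and, if_false, Finset.sum_const, nsmul_eq_mul, mul_one]
    rw [← Set.ncard_eq_toFinset_card _ A.toFinite, add_mul, one_mul]
    exact le_self_add

theorem expect_pow_faultCount_le {V : Type*} [Fintype V] [Fintype F] [Finite W]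
    (φ : Module.Dual F W) (A : V → Set W) (hA : ∀ v, (A v).Nonempty) (l : ℝ≥0∞) :
    expect (uniformPi A hA) (fun y => l ^ faultCount φ A y) ≤
      (1 + l * (Fintype.card F : ℝ≥0∞)⁻¹) ^ Fintype.card V := by
  classical
  have h : ∀ y : V → W, l ^ faultCount φ A y =
      ∏ v, if Mixing φ (A v) ∧ φ (y v) = 0 then l else 1 := by
    intro y
    rw [Finset.prod_ite, Finset.prod_const, Finset.prod_const_one, mul_one, faultCount,
      Set.ncard_eq_toFinset_card']
    congr 2
    ext; simp
  simp only [h]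
  rw [expect_uniformPi_prod A hA fun v w => if Mixing φ (A v) ∧ φ w = 0 then l else 1]
  refine (Finset.prod_le_prod' fun v _ => Mixing.sum_le (hA v) l).trans ?_
  simp

end Fault

/-! ### Exponential moments of the number of faults -/

section Runs

variable {V F : Type*} [Field F] {k : ℕ}

/-- The faults with respect to `φ` in the round `r` that follows the history `h`. -/
noncomputable def roundFaults (σ : Scheme) (src : V → Set (Fin k)) (adv : Adversary V F k)
    (φ : Module.Dual F (Fin k → F)) (h : History V F k) (r : Round V F k) : ℕ :=
  faultCount φ (fun v => (activeSpan (src v) (memory h v) : Set (Fin k → F))) r.sent +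
    faultCount φ (fun v => updateSet σ (memory h v) (incoming (adv h) r.sent v)) r.stored

/-- The number of all faults with respect to `φ` in a history. -/
noncomputable def totalFaults (σ : Scheme) (src : V → Set (Fin k)) (adv : Adversary V F k)
    (φ : Module.Dual F (Fin k → F)) : History V F k → ℕ
  | [] => 0
  | r :: h => totalFaults σ src adv φ h + roundFaults σ src adv φ h r

/-- The memory updates are bounded conditionally on the packets sent, uniformly in them; the square
accounts for the two batches of independent draws. -/
theorem expect_pow_roundFaults_le [Fintype V] [Fintype F] (σ : Scheme) (src : V → Set (Fin k))
    (adv : Adversary V F k) (φ : Module.Dual F (Fin k → F)) (h : History V F k) (l : ℝ≥0∞) :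
    expect (step σ src adv h) (fun r => l ^ roundFaults σ src adv φ h r) ≤
      ((1 + l * (Fintype.card F : ℝ≥0∞)⁻¹) ^ Fintype.card V) ^ 2 := by
  simp only [step, expect_bind, expect_map, roundFaults, pow_add, expect_const_mul]
  refine (expect_mono _ fun p => mul_le_mul_right (expect_pow_faultCount_le φ _ _ l) _).trans ?_
  rw [expect_mul_const, sq]
  exact mul_le_mul_left (expect_pow_faultCount_le φ _ _ l) _

/-- The one-round bound is the same for every history, so adaptivity does not matter and the factors
multiply. -/
theorem expect_pow_totalFaults_le [Fintype V] [Fintype F] (σ : Scheme) (src : V → Set (Fin k))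
    (adv : Adversary V F k) (φ : Module.Dual F (Fin k → F)) (l : ℝ≥0∞) (t : ℕ) :
    expect (run σ src adv t) (fun h => l ^ totalFaults σ src adv φ h) ≤
      (((1 + l * (Fintype.card F : ℝ≥0∞)⁻¹) ^ Fintype.card V) ^ 2) ^ t := by
  induction t with
  | zero => simp [run, expect_pure, totalFaults]
  | succ t ih =>
    simp only [run, expect_bind, expect_map, totalFaults, pow_add, expect_const_mul]
    refine (expect_mono _ fun h =>
      mul_le_mul_right (expect_pow_roundFaults_le σ src adv φ h l) _).trans ?_
    rw [expect_mul_const]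
    simpa using mul_le_mul_left ih _

end Runs

/-! ### The growth of the set of aware nodes -/

section Potential

/-- The potential of a set of `s` out of `n` nodes: at expansion rate `H` it takes about
`max 1 (H * min j (n - j))⁻¹` windows to proceed from `j` nodes to `j + 1`. -/
noncomputable def potential (n : ℕ) (H : ℝ) (s : ℕ) : ℝ :=
  ∑ j ∈ Finset.range s, (max 1 (H * min ((j : ℝ) + 1) (n - (j + 1))))⁻¹

theorem potential_le_add {n : ℕ} {H : ℝ} {s s' d : ℕ} (h : s ≤ s' + d) :
    potential n H s ≤ potential n H s' + d := by
  have hmono : potential n H s ≤ potential n H (s' + d) := by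
    refine Finset.sum_le_sum_of_subset_of_nonneg (Finset.range_mono h) fun _ _ _ => ?_
    positivity
  refine hmono.trans ?_
  rw [potential, Finset.sum_range_add, potential]
  gcongr
  calc _ ≤ ∑ _j ∈ Finset.range d, (1 : ℝ) :=
        Finset.sum_le_sum fun j _ => inv_le_one_of_one_le₀ (le_max_left _ _)
    _ = d := by simp

/-- At least `⌈D⌉₊` new terms appear, and each of the first `⌈D⌉₊` is at least `1 / (4 * D)`. The
bound `H ≤ 2` ensures that `s + j + 1 ≤ 4 * s` for these terms when `s` is the smaller side; when `n
- s` is smaller, `n - (s + j + 1)` only decreases. -/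
theorem potential_growth {n : ℕ} {H : ℝ} (hH : 0 < H) (hH2 : H ≤ 2) {s s' : ℕ} (hs : 1 ≤ s)
    (h1 : s + 1 ≤ s') (h2 : H * min ((n : ℝ) - s) s ≤ (s' : ℝ) - s) :
    potential n H s + 1 / 4 ≤ potential n H s' := by
  set D : ℝ := max 1 (H * min ((n : ℝ) - s) s) with hD
  have hD1 : 1 ≤ D := le_max_left _ _
  have hs1 : (1 : ℝ) ≤ s := by exact_mod_cast hs
  have hs' : (s : ℝ) + 1 ≤ s' := by exact_mod_cast h1
  have hDs : D ≤ (s' : ℝ) - s := max_le (by linarith) h2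
  have hc : s + ⌈D⌉₊ ≤ s' := by
    have : ⌈D⌉₊ ≤ s' - s := by
      rw [Nat.ceil_le, Nat.cast_sub (by omega)]
      exact hDs
    omega
  have hmono : potential n H (s + ⌈D⌉₊) ≤ potential n H s' := by
    refine Finset.sum_le_sum_of_subset_of_nonneg (Finset.range_mono hc) fun _ _ _ => ?_
    positivity
  refine le_trans ?_ hmono
  rw [potential, potential, Finset.sum_range_add]
  gcongr
  have hterm : ∀ j ∈ Finset.range ⌈D⌉₊, (4 * D)⁻¹ ≤
      (max 1 (H * min (((s + j : ℕ) : ℝ) + 1) (n - (((s + j : ℕ) : ℝ) + 1))))⁻¹ := by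
    intro j hj
    have hj' : (j : ℝ) + 1 ≤ ⌈D⌉₊ := by exact_mod_cast Finset.mem_range.1 hj
    have hj0 : (0 : ℝ) ≤ j := Nat.cast_nonneg j
    have hceil : (⌈D⌉₊ : ℝ) < D + 1 := Nat.ceil_lt_add_one (by linarith)
    refine inv_anti₀ (by positivity) (max_le (by linarith) ?_)
    push_cast
    rcases le_total ((n : ℝ) - s) s with hns | hns
    · have hD' : H * ((n : ℝ) - s) ≤ D := by
        rw [hD, min_eq_left hns]; exact le_max_right _ _
      calc _ ≤ H * ((n : ℝ) - s) := by
            gcongr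
            exact (min_le_right _ _).trans (by linarith)
        _ ≤ 4 * D := by linarith
    · have hD' : H * s ≤ D := by
        rw [hD, min_eq_right hns]; exact le_max_right _ _
      have hD2 : D ≤ 2 * s := by
        rw [hD, min_eq_right hns]
        exact max_le (by linarith) (by gcongr)
      calc _ ≤ H * (4 * s) := by
            gcongr
            exact (min_le_left _ _).trans (by linarith)
        _ ≤ 4 * D := by linarith
  calc (1 : ℝ) / 4 = D * (4 * D)⁻¹ := by field_simp
    _ ≤ ⌈D⌉₊ * (4 * D)⁻¹ := by gcongr; exact Nat.le_ceil D
    _ = ∑ _j ∈ Finset.range ⌈D⌉₊, (4 * D)⁻¹ := by simp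
    _ ≤ _ := Finset.sum_le_sum hterm

/-- The primitive of `x ↦ 1 / max 1 (a * x)` that vanishes at `0`. -/
noncomputable def truncLog (a x : ℝ) : ℝ := if a * x ≤ 1 then x else (1 + Real.log (a * x)) / a

/-- The integrand decreases, so its value at the right endpoint bounds the integral over `[m, m +
1]`. The proof compares primitives directly, according to the position of `1 / a`. -/
theorem inv_max_le_truncLog_sub {a : ℝ} (ha : 0 < a) (m : ℕ) :
    (max 1 (a * ((m : ℝ) + 1)))⁻¹ ≤ truncLog a (m + 1) - truncLog a m := by
  have hm : (0 : ℝ) ≤ m := Nat.cast_nonneg m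
  rcases le_or_gt (a * ((m : ℝ) + 1)) 1 with h | h
  · have h' : a * m ≤ 1 := by nlinarith
    simp [truncLog, h, h']
  · rw [max_eq_right h.le, truncLog, if_neg h.not_ge, truncLog]
    split_ifs with h'
    · have hl := Real.one_sub_inv_le_log_of_pos (lt_trans one_pos h)
      set u := a * ((m : ℝ) + 1) with hu
      have hm' : (m : ℝ) = u / a - 1 := by rw [hu]; field_simp; ring
      have hu1 : u - 1 ≤ a := by rw [hu]; linarith
      have hu0 : 0 < u := lt_trans one_pos h
      calc u⁻¹ ≤ (2 - u⁻¹) / a - (u / a - 1) := by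
            rw [← sub_nonneg]
            have : (2 - u⁻¹) / a - (u / a - 1) - u⁻¹ = (u - 1) * (a - (u - 1)) / (u * a) := by
              field_simp; ring
            rw [this]
            exact div_nonneg (mul_nonneg (by linarith) (by linarith)) (by positivity)
        _ ≤ (1 + Real.log u) / a - m := by
            rw [hm']; gcongr; linarith
    · push Not at h'
      have hm0 : (0 : ℝ) < m := by
        rcases hm.eq_or_lt with h0 | h0
        · rw [← h0] at h'; norm_num at h'
        · exact h0
      have hl := Real.one_sub_inv_le_log_of_pos (x := ((m : ℝ) + 1) / m) (by positivity)
      rw [← sub_div, Real.log_mul ha.ne' (by positivity), Real.log_mul ha.ne' hm0.ne']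
      rw [Real.log_div (by positivity) hm0.ne'] at hl
      have : 1 - (((m : ℝ) + 1) / m)⁻¹ = ((m : ℝ) + 1)⁻¹ := by field_simp; ring
      rw [this] at hl
      rw [mul_inv, ← div_eq_inv_mul]
      gcongr
      linarith

theorem sum_inv_max_le {a : ℝ} (ha : 0 < a) (m : ℕ) :
    ∑ j ∈ Finset.range m, (max 1 (a * ((j : ℝ) + 1)))⁻¹ ≤ truncLog a m := by
  induction m with
  | zero => simp [truncLog]
  | succ m ih =>
    rw [Finset.sum_range_succ]
    have := inv_max_le_truncLog_sub ha m
    push_cast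
    linarith

theorem truncLog_le {a x : ℝ} (ha : 0 < a) :
    truncLog a x ≤ 2 * (max 1 (Real.log (x * a)) / a) := by
  have h1 : (1 : ℝ) ≤ max 1 (Real.log (x * a)) := le_max_left _ _
  have h2 := le_max_right (1 : ℝ) (Real.log (x * a))
  rw [← mul_div_assoc, truncLog]
  split_ifs with h
  · rw [le_div_iff₀ ha]; nlinarith
  · rw [mul_comm a x]; gcongr; linarith

theorem potential_le {n : ℕ} {H : ℝ} (hH : 0 < H) {s : ℕ} (hs : s < n) :
    potential n H s ≤ 4 * (max 1 (Real.log (n * H)) / H) := by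
  have hterm : ∀ j ∈ Finset.range n, (max 1 (H * min ((j : ℝ) + 1) (n - (j + 1))))⁻¹ ≤
      (max 1 (H * ((j : ℝ) + 1)))⁻¹ + (max 1 (H * ((n : ℝ) - (j + 1))))⁻¹ := by
    intro j _
    rcases le_total ((j : ℝ) + 1) (n - (j + 1)) with h | h
    · rw [min_eq_left h]; exact le_add_of_nonneg_right (by positivity)
    · rw [min_eq_right h]; exact le_add_of_nonneg_left (by positivity)
  -- Since `s < n`, only indices below `m = n - 1` occur, and the reflection of `range m` maps `n -
  -- (j + 1)` to `j + 1`.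
  obtain ⟨m, rfl⟩ : ∃ m, n = m + 1 := ⟨n - 1, by omega⟩
  have hmono : potential (m + 1) H s ≤ potential (m + 1) H m := by
    refine Finset.sum_le_sum_of_subset_of_nonneg (Finset.range_mono (by omega)) fun _ _ _ => ?_
    positivity
  have hrefl : ∑ j ∈ Finset.range m, (max 1 (H * (((m + 1 : ℕ) : ℝ) - (j + 1))))⁻¹ =
      ∑ j ∈ Finset.range m, (max 1 (H * ((j : ℝ) + 1)))⁻¹ := by
    rw [← Finset.sum_range_reflect]
    refine Finset.sum_congr rfl fun j hj => ?_
    have hj' := Finset.mem_range.1 hj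
    have : ((m - 1 - j : ℕ) : ℝ) = m - 1 - j := by
      rw [Nat.sub_sub, Nat.cast_sub (by omega)]; push_cast; ring
    rw [this]; push_cast; ring_nf
  have hsum : ∑ j ∈ Finset.range m, (max 1 (H * ((j : ℝ) + 1)))⁻¹ ≤ truncLog H (m + 1 : ℕ) :=
    (Finset.sum_le_sum_of_subset_of_nonneg (Finset.range_mono (Nat.le_succ m))
      fun _ _ _ => by positivity).trans (sum_inv_max_le hH (m + 1))
  have hfin := truncLog_le (x := ((m + 1 : ℕ) : ℝ)) hH
  refine hmono.trans ((Finset.sum_le_sum fun j hj =>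
    hterm j (Finset.range_mono (Nat.le_succ m) hj)).trans ?_)
  rw [Finset.sum_add_distrib, hrefl]
  linarith

end Potential

/-! ### Deterministic spreading under relaxed isoperimetry -/

section Spreading

variable {V : Type*}

/-- A set of `⌊N / 2⌋` of the `N` nodes can gain at most twice its own size, because `N ≤ 3 * ⌊N /
2⌋` for `N ≥ 2`. -/
theorem HasRelaxedIsoperimetricNumber.le_two [Fintype V] {G : ℕ → Digraph V} {Δ : ℕ} {H : ℝ} (hΔ : 1 ≤ Δ)
    (hH : 0 < H) (h : HasRelaxedIsoperimetricNumber G Δ H) (hV : 2 ≤ Fintype.card V) : H ≤ 2 := by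
  obtain ⟨S, -, hS⟩ := Set.exists_subset_card_eq (s := (Set.univ : Set V))
    (n := Fintype.card V / 2) (by rw [Set.ncard_univ, Nat.card_eq_fintype_card]; omega)
  have hcompl := Set.ncard_add_ncard_compl S
  rw [Nat.card_eq_fintype_card] at hcompl
  have hne : S.Nonempty := (Set.ncard_pos).1 (by omega)
  have hnu : S ≠ Set.univ := by
    rintro rfl
    rw [Set.ncard_univ, Nat.card_eq_fintype_card] at hS
    omega
  have h0 := h S hne hnu 0
  set U := ⋃ j ∈ Finset.range Δ, iterNbhd G 0 j S
  have hU : U.ncard ≤ Fintype.card V := by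
    rw [← Nat.card_eq_fintype_card]; exact Set.ncard_le_card U
  have hSc : S.ncard ≤ Sᶜ.ncard := by omega
  have hS1 : (1 : ℝ) ≤ S.ncard := by exact_mod_cast (by omega : 1 ≤ S.ncard)
  have hΔ' : (1 : ℝ) ≤ Δ := by exact_mod_cast hΔ
  rw [min_eq_right (by exact_mod_cast hSc), le_div_iff₀ (by positivity)] at h0
  have h3 : (U.ncard : ℝ) ≤ 3 * S.ncard := by exact_mod_cast (by omega : U.ncard ≤ 3 * S.ncard)
  have h4 : H * S.ncard ≤ H * (S.ncard * Δ) := by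
    gcongr; nlinarith
  nlinarith

theorem iterNbhd_subset {G : ℕ → Digraph V} {S : ℕ → Set V} {t Δ : ℕ}
    (h : ∀ i < Δ, closedNbhd (G (t + i)) (S (t + i)) ⊆ S (t + i + 1)) {j : ℕ} (hj : j < Δ) :
    iterNbhd G t j (S t) ⊆ S (t + j + 1) := by
  induction j with
  | zero => exact h 0 hj
  | succ j ih =>
    refine subset_trans ?_ (h (j + 1) hj)
    have ih' := ih (by omega)
    rintro v (hv | ⟨u, hu, huv⟩)
    · exact Or.inl (ih' hv)
    · exact Or.inr ⟨u, ih' hu, huv⟩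

theorem ncard_le_add_sum {S : ℕ → Set V} {f : ℕ → ℕ}
    (hlose : ∀ t, (S t).ncard ≤ (S (t + 1)).ncard + f t) (t d : ℕ) :
    (S t).ncard ≤ (S (t + d)).ncard + ∑ i ∈ Finset.range d, f (t + i) := by
  induction d with
  | zero => simp
  | succ d ih =>
    have := hlose (t + d)
    rw [Finset.sum_range_succ, ← add_assoc t d 1]
    omega

theorem potential_window [Fintype V] {G : ℕ → Digraph V} {Δ : ℕ} {H : ℝ} (hΔ : 1 ≤ Δ) (hH : 0 < H)
    (hG : HasRelaxedIsoperimetricNumber G Δ H) (hV : 2 ≤ Fintype.card V)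
    {S : ℕ → Set V} {f : ℕ → ℕ} (hne : ∀ t, (S t).Nonempty) {t : ℕ} (hnu : S t ≠ Set.univ)
    (hlose : ∀ t, (S t).ncard ≤ (S (t + 1)).ncard + f t)
    (hgrow : ∀ t, f t = 0 → closedNbhd (G t) (S t) ⊆ S (t + 1)) :
    potential (Fintype.card V) H (S t).ncard + 1 / 4 ≤
      potential (Fintype.card V) H (S (t + Δ)).ncard +
        5 / 4 * ((∑ i ∈ Finset.range Δ, f (t + i) : ℕ) : ℝ) := by
  rcases Nat.eq_zero_or_pos (∑ i ∈ Finset.range Δ, f (t + i)) with h0 | h0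
  · rw [h0, Nat.cast_zero, mul_zero, add_zero]
    have hf : ∀ i < Δ, f (t + i) = 0 := by
      simpa [Finset.sum_eq_zero_iff] using h0
    have hstep : ∀ i < Δ, closedNbhd (G (t + i)) (S (t + i)) ⊆ S (t + i + 1) :=
      fun i hi => hgrow _ (hf i hi)
    have hmono : ∀ d, d ≤ Δ → ∀ i ≤ d, S (t + i) ⊆ S (t + d) := by
      intro d
      induction d with
      | zero => intro _ i hi; rw [Nat.le_zero.1 hi]
      | succ d ih =>
        intro hd i hi
        rcases Nat.le_succ_iff.1 hi with hi | rfl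
        · exact (ih (by omega) i hi).trans
            (subset_trans Set.subset_union_left (hstep d (by omega)))
        · exact subset_rfl
    have hU : (⋃ j ∈ Finset.range Δ, iterNbhd G t j (S t)) ⊆ S (t + Δ) := by
      refine Set.iUnion₂_subset fun j hj => ?_
      have hj' := Finset.mem_range.1 hj
      exact (iterNbhd_subset hstep hj').trans (hmono Δ le_rfl (j + 1) hj')
    have hUcard : ((⋃ j ∈ Finset.range Δ, iterNbhd G t j (S t)).ncard : ℝ) ≤
        (S (t + Δ)).ncard := by exact_mod_cast Set.ncard_le_ncard hU
    have hs : 1 ≤ (S t).ncard := (Set.ncard_pos).2 (hne t)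
    have hcompl : 1 ≤ (S t)ᶜ.ncard := (Set.ncard_pos).2 (Set.nonempty_compl.2 hnu)
    have hadd : ((S t).ncard : ℝ) + (S t)ᶜ.ncard = Fintype.card V := by
      rw [← Nat.card_eq_fintype_card]; exact_mod_cast Set.ncard_add_ncard_compl (S t)
    have hΔ' : (1 : ℝ) ≤ Δ := by exact_mod_cast hΔ
    have hmin : (0 : ℝ) < min ((S t)ᶜ.ncard : ℝ) (S t).ncard :=
      lt_min (by exact_mod_cast hcompl) (by exact_mod_cast hs)
    have hiso := hG (S t) (hne t) hnu t
    rw [le_div_iff₀ (by positivity)] at hiso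
    -- The factor `Δ ≥ 1` in the guaranteed growth is simply discarded.
    have hge : H * min ((S t)ᶜ.ncard : ℝ) (S t).ncard ≤ (S (t + Δ)).ncard - (S t).ncard := by
      have : H * min ((S t)ᶜ.ncard : ℝ) (S t).ncard * 1 ≤
          H * min ((S t)ᶜ.ncard : ℝ) (S t).ncard * Δ := by gcongr
      linarith
    refine potential_growth hH (hG.le_two hΔ hH hV) hs ?_ ?_
    · have : ((S t).ncard : ℝ) < (S (t + Δ)).ncard := by
        have := mul_pos hH hmin
        linarith
      exact_mod_cast this
    · rw [← hadd, add_sub_cancel_left]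
      exact hge
  -- With a positive loss `f` in the window, the potential drops by at most the total loss, and the
  -- missing `1 / 4` is charged to that loss too; hence `5 / 4`.
  · have h1 := potential_le_add (n := Fintype.card V) (H := H) (ncard_le_add_sum hlose t Δ)
    have h2 : (1 : ℝ) ≤ ((∑ i ∈ Finset.range Δ, f (t + i) : ℕ) : ℝ) := by exact_mod_cast h0
    linarith

/-- If the sets `S t` lose at most `f t` elements per round and expand in all rounds with
`f t = 0`, then they fill `V` unless the sum of the `f t` is large. -/
theorem windows_le_of_forall_ne_univ [Fintype V] {G : ℕ → Digraph V} {Δ : ℕ} {H : ℝ} (hΔ : 1 ≤ Δ)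
    (hH : 0 < H) (hG : HasRelaxedIsoperimetricNumber G Δ H) (hV : 2 ≤ Fintype.card V)
    {S : ℕ → Set V} {f : ℕ → ℕ} (hne : ∀ t, (S t).Nonempty)
    (hlose : ∀ t, (S t).ncard ≤ (S (t + 1)).ncard + f t)
    (hgrow : ∀ t, f t = 0 → closedNbhd (G t) (S t) ⊆ S (t + 1))
    {T : ℕ} (hnu : ∀ t ≤ T, S t ≠ Set.univ) :
    ((T / Δ : ℕ) : ℝ) ≤ 16 * (max 1 (Real.log (Fintype.card V * H)) / H) +
      5 * ((∑ t ∈ Finset.range T, f t : ℕ) : ℝ) := by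
  have hind : ∀ w, w * Δ ≤ T → (w : ℝ) / 4 ≤ potential (Fintype.card V) H (S (w * Δ)).ncard +
      5 / 4 * ((∑ t ∈ Finset.range (w * Δ), f t : ℕ) : ℝ) := by
    intro w
    induction w with
    | zero =>
      intro _
      have : 0 ≤ potential (Fintype.card V) H (S (0 * Δ)).ncard :=
        Finset.sum_nonneg fun _ _ => by positivity
      simpa using this
    | succ w ih =>
      intro hw
      have hw' : w * Δ + Δ ≤ T := by rwa [Nat.succ_mul] at hw
      have h1 := ih (by omega)
      have h2 := potential_window hΔ hH hG hV hne (hnu (w * Δ) (by omega)) hlose hgrow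
      rw [Nat.succ_mul, Finset.sum_range_add]
      push_cast at h1 h2 ⊢
      linarith
  have hT : T / Δ * Δ ≤ T := Nat.div_mul_le_self T Δ
  have h1 := hind _ hT
  have hlt : (S (T / Δ * Δ)).ncard < Fintype.card V := by
    rw [← Nat.card_eq_fintype_card, ← Set.ncard_univ]
    exact Set.ncard_lt_ncard ((Set.ssubset_univ_iff).2 (hnu _ hT))
  have h2 := potential_le hH hlt
  have h3 : ((∑ t ∈ Finset.range (T / Δ * Δ), f t : ℕ) : ℝ) ≤
      ((∑ t ∈ Finset.range T, f t : ℕ) : ℝ) := by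
    exact_mod_cast Finset.sum_le_sum_of_subset (Finset.range_mono hT)
  linarith

end Spreading

/-! ### Histories -/

section Histories

variable {V F : Type*} {k : ℕ}

/-- The history that continues `h` by the first `j` rounds of `τ`. -/
def continueHistory (h : History V F k) (τ : ℕ → Round V F k) : ℕ → History V F k
  | 0 => h
  | j + 1 => τ j :: continueHistory h τ j

theorem continueHistory_cons (h : History V F k) (r : Round V F k) (τ : ℕ → Round V F k) (j : ℕ) :
    continueHistory h (fun i => Nat.casesOn i r τ) (j + 1) = continueHistory (r :: h) τ j := by
  induction j with
  | zero => rfl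
  | succ j ih => rw [continueHistory, ih]; rfl

theorem continueHistory_nil (τ : ℕ → Round V F k) (j : ℕ) :
    continueHistory [] τ j = historyOf τ j := by
  induction j with
  | zero => rfl
  | succ j ih => rw [continueHistory, ih]; rfl

theorem received_historyOf_mono (adv : Adversary V F k) (ω : ℕ → Round V F k) (v : V) :
    Monotone fun t => received adv (historyOf ω t) v :=
  monotone_nat_of_le_succ fun _ => Set.subset_union_left

end Histories

/-! ### Aware nodes -/

section Aware

variable {V F : Type*} [Field F] {k : ℕ}

/-- The nodes some active packet of which is not annihilated by `φ`. -/
def awareSet (φ : Module.Dual F (Fin k → F)) (src : V → Set (Fin k)) (h : History V F k) : Set V :=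
  {v | ¬ activeSpan (src v) (memory h v) ≤ LinearMap.ker φ}

theorem activeSpan_le_ker_iff {φ : Module.Dual F (Fin k → F)} {M : Set (Fin k)} {x : Fin k → F} :
    activeSpan M x ≤ LinearMap.ker φ ↔ φ x = 0 ∧ ∀ c ∈ ownPackets F M, φ c = 0 := by
  rw [activeSpan, Submodule.span_le, Set.insert_subset_iff]
  rfl

theorem Mixing.of_submodule {W : Type*} [AddCommGroup W] [Module F W] {φ : Module.Dual F W}
    {U : Submodule F W} (h : ¬ U ≤ LinearMap.ker φ) : Mixing φ (U : Set W) := by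
  obtain ⟨u, hu, hφ⟩ := SetLike.not_le_iff_exists.1 h
  exact ⟨u, hφ, fun y hy c => U.add_mem hy (U.smul_mem c hu)⟩

theorem mixing_updateSet_of_mem (σ : Scheme) {φ : Module.Dual F (Fin k → F)} (x : Fin k → F)
    {P : Set (Fin k → F)} {c : Fin k → F} (hc : c ∈ P) (hφ : φ c ≠ 0) :
    Mixing φ (updateSet σ x P) := by
  refine ⟨c, hφ, fun y hy a => ?_⟩
  cases σ with
  | accumulator =>
    have : y + a • c - x = (y - x) + a • c := by abel
    simp only [updateSet, Set.mem_ofPred_eq, this] at hy ⊢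
    exact Submodule.add_mem _ hy (Submodule.smul_mem _ _ (Submodule.subset_span hc))
  | recombinator =>
    refine ⟨fun hP => absurd hc (by simp [hP]), ?_⟩
    exact Submodule.add_mem _ hy.2
      (Submodule.smul_mem _ _ (Submodule.subset_span (Set.mem_insert_of_mem _ hc)))

/-- A memory packet visible to `φ` can become invisible only by chance. The accumulator must have
received a visible packet, as otherwise `φ y = φ x`; the recombinator can use the direction `x`
itself, since an empty reception would force `y = x`. -/
theorem mixing_updateSet_of_ne (σ : Scheme) {φ : Module.Dual F (Fin k → F)} {x y : Fin k → F}
    {P : Set (Fin k → F)} (hy : y ∈ updateSet σ x P) (hx : φ x ≠ 0) (hy0 : φ y = 0) :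
    Mixing φ (updateSet σ x P) := by
  cases σ with
  | accumulator =>
    by_cases hP : ∃ c ∈ P, φ c ≠ 0
    · obtain ⟨c, hc, hφ⟩ := hP
      exact mixing_updateSet_of_mem _ x hc hφ
    · push Not at hP
      have : y - x ∈ LinearMap.ker φ := (Submodule.span_le (p := LinearMap.ker φ)).2 hP hy
      rw [LinearMap.mem_ker, map_sub, hy0, zero_sub, neg_eq_zero] at this
      exact absurd this hx
  | recombinator =>
    refine ⟨x, hx, fun z hz a => ⟨fun hP => ?_, ?_⟩⟩
    · exact absurd hy0 (by rw [hy.1 hP]; exact hx)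
    · exact Submodule.add_mem _ hz.2
        (Submodule.smul_mem _ _ (Submodule.subset_span (Set.mem_insert _ _)))

theorem eq_zero_of_faultCount_eq_zero [Finite V] {W : Type*} [AddCommGroup W] [Module F W]
    {φ : Module.Dual F W} {A : V → Set W} {y : V → W} (h : faultCount φ A y = 0) {v : V}
    (hv : Mixing φ (A v)) : φ (y v) ≠ 0 := by
  intro h0
  rw [faultCount, Set.ncard_eq_zero (Set.toFinite _)] at h
  exact (h ▸ (⟨hv, h0⟩ : v ∈ {v | Mixing φ (A v) ∧ φ (y v) = 0}) : v ∈ (∅ : Set V))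

variable {σ : Scheme} {src : V → Set (Fin k)} {adv : Adversary V F k}

/-- Own packets are kept for ever, so a node that ceases to be aware had a memory packet visible to
`φ` and lost it. -/
theorem awareSet_diff_subset (φ : Module.Dual F (Fin k → F)) {h : History V F k} {r : Round V F k}
    (hr : ∀ v, r.stored v ∈ updateSet σ (memory h v) (incoming (adv h) r.sent v)) :
    awareSet φ src h \ awareSet φ src (r :: h) ⊆
      {v | Mixing φ (updateSet σ (memory h v) (incoming (adv h) r.sent v)) ∧
        φ (r.stored v) = 0} := by
  rintro v ⟨hv, hv'⟩
  simp only [awareSet, Set.mem_ofPred_eq, not_not, activeSpan_le_ker_iff, memory] at hv hv'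
  have hx : φ (memory h v) ≠ 0 := fun h0 => hv ⟨h0, hv'.2⟩
  exact ⟨mixing_updateSet_of_ne σ (hr v) hx hv'.1, hv'.1⟩

theorem ncard_awareSet_le [Finite V] (φ : Module.Dual F (Fin k → F)) {h : History V F k}
    {r : Round V F k}
    (hr : ∀ v, r.stored v ∈ updateSet σ (memory h v) (incoming (adv h) r.sent v)) :
    (awareSet φ src h).ncard ≤
      (awareSet φ src (r :: h)).ncard + roundFaults σ src adv φ h r := by
  have h1 := Set.ncard_le_ncard_sdiff_add_ncard (awareSet φ src h) (awareSet φ src (r :: h))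
    (Set.toFinite _)
  have h2 := Set.ncard_le_ncard (awareSet_diff_subset (src := src) φ hr) (Set.toFinite _)
  simp only [roundFaults, faultCount]
  omega

/-- Without faults an aware node sends a packet visible to `φ`; this makes the update of each
receiver mixing, so the new memory is visible too. -/
theorem closedNbhd_awareSet_subset [Finite V] (φ : Module.Dual F (Fin k → F)) {h : History V F k}
    {r : Round V F k}
    (hr : ∀ v, r.stored v ∈ updateSet σ (memory h v) (incoming (adv h) r.sent v))
    (h0 : roundFaults σ src adv φ h r = 0) :
    closedNbhd (adv h) (awareSet φ src h) ⊆ awareSet φ src (r :: h) := by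
  obtain ⟨h1, h2⟩ := Nat.add_eq_zero_iff.1 h0
  rintro v (hv | ⟨u, hu, huv⟩)
  · by_contra hv'
    obtain ⟨hm, hz⟩ := awareSet_diff_subset φ hr ⟨hv, hv'⟩
    exact eq_zero_of_faultCount_eq_zero h2 hm hz
  · have hs := eq_zero_of_faultCount_eq_zero h1 (Mixing.of_submodule hu)
    have hm : Mixing φ (updateSet σ (memory h v) (incoming (adv h) r.sent v)) :=
      mixing_updateSet_of_mem σ _ ⟨u, huv, rfl⟩ hs
    exact fun hle => eq_zero_of_faultCount_eq_zero h2 hm (activeSpan_le_ker_iff.1 hle).1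

/-- Some `e_i` is visible to `φ`, and a node holding message `i` from the start remains aware for
ever. This keeps faults from extinguishing the spread. -/
theorem awareSet_nonempty {φ : Module.Dual F (Fin k → F)} (hφ : φ ≠ 0)
    (hsrc : ∀ i : Fin k, ∃ v : V, i ∈ src v) (h : History V F k) : (awareSet φ src h).Nonempty := by
  have : ∃ i, φ (Pi.single i 1) ≠ 0 := by
    by_contra! hall
    exact hφ ((Pi.basisFun F (Fin k)).ext fun i => by simpa using hall i)
  obtain ⟨i, hi⟩ := this
  obtain ⟨v, hv⟩ := hsrc i
  exact ⟨v, fun hle => hi ((activeSpan_le_ker_iff.1 hle).2 _ ⟨i, hv, rfl⟩)⟩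

/-! ### Possible runs -/

theorem mem_updateSet_of_mem_support_step [Finite V] [Finite F] {h : History V F k}
    {r : Round V F k} (hr : r ∈ (step σ src adv h).support) (v : V) :
    r.stored v ∈ updateSet σ (memory h v) (incoming (adv h) r.sent v) := by
  simp only [step, PMF.mem_support_bind_iff, PMF.mem_support_map_iff] at hr
  obtain ⟨p, -, y, hy, rfl⟩ := hr
  exact mem_of_mem_support_uniformPi hy v

theorem mem_support_run_succ [Finite V] [Finite F] {t : ℕ} {h : History V F k} :
    h ∈ (run σ src adv (t + 1)).support ↔
      ∃ h' ∈ (run σ src adv t).support, ∃ r ∈ (step σ src adv h').support, r :: h' = h := by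
  simp only [run, PMF.mem_support_bind_iff, PMF.mem_support_map_iff]

theorem memory_mem_span_received [Finite V] [Finite F] {t : ℕ} {h : History V F k}
    (hh : h ∈ (run σ src adv t).support) (v : V) :
    memory h v ∈ Submodule.span F (received adv h v) := by
  induction t generalizing h with
  | zero =>
    obtain rfl : h = [] := by simpa [run] using hh
    exact Submodule.zero_mem _
  | succ t ih =>
    obtain ⟨h', hh', r, hr, rfl⟩ := mem_support_run_succ.1 hh
    have hx : memory h' v ∈ Submodule.span F (received adv (r :: h') v) :=
      Submodule.span_mono Set.subset_union_left (ih hh')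
    have hP : Submodule.span F (incoming (adv h') r.sent v) ≤
        Submodule.span F (received adv (r :: h') v) := Submodule.span_mono Set.subset_union_right
    have hy := mem_updateSet_of_mem_support_step hr v
    cases σ with
    | accumulator => simpa [memory] using Submodule.add_mem _ (hP hy) hx
    | recombinator =>
      refine (Submodule.span_le.2 (Set.insert_subset_iff.2 ⟨hx, ?_⟩)) hy.2
      exact Submodule.span_le.1 hP

theorem exists_run_of_continueHistory [Finite V] [Finite F] {t : ℕ} {h : History V F k}
    (hh : h ∈ (run σ src adv t).support) (τ : ℕ → Round V F k)
    (hτ : ∀ j, continueHistory h τ j ∈ (run σ src adv (t + j)).support) :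
    ∃ ω : ℕ → Round V F k, historyOf ω t = h ∧ (∀ j, ω (t + j) = τ j) ∧
      ∀ s, historyOf ω s ∈ (run σ src adv s).support := by
  induction t generalizing h τ with
  | zero =>
    obtain rfl : h = [] := by simpa [run] using hh
    exact ⟨τ, rfl, fun j => by rw [zero_add], fun s => by
      simpa [continueHistory_nil] using hτ s⟩
  | succ t ih =>
    obtain ⟨h', hh', r, -, rfl⟩ := mem_support_run_succ.1 hh
    obtain ⟨ω, h1, h2, h3⟩ := ih hh' (fun i => Nat.casesOn i r τ) fun j => by
      cases j with
      | zero => exact hh'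
      | succ j =>
        rw [continueHistory_cons, ← add_assoc, add_right_comm]
        exact hτ j
    refine ⟨ω, ?_, fun j => ?_, h3⟩
    · rw [historyOf, h1, show ω t = r from h2 0]
    · rw [add_right_comm, add_assoc]
      exact h2 (j + 1)

/-- The isoperimetry guarantee concerns infinite possible runs, so a finite history has to be
prolonged, by any possible round each time. -/
theorem exists_run_of_mem_support [Finite V] [Finite F] {t : ℕ} {h : History V F k}
    (hh : h ∈ (run σ src adv t).support) :
    ∃ ω : ℕ → Round V F k, historyOf ω t = h ∧
      ∀ s, historyOf ω s ∈ (run σ src adv s).support := by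
  choose next hnext using fun g : History V F k => (step σ src adv g).support_nonempty
  let g : ℕ → History V F k := fun j => Nat.rec h (fun _ g => next g :: g) j
  have hg : ∀ j, continueHistory h (fun i => next (g i)) j = g j := by
    intro j
    induction j with
    | zero => rfl
    | succ j ih => rw [continueHistory, ih]
  obtain ⟨ω, h1, -, h3⟩ := exists_run_of_continueHistory hh (fun i => next (g i)) fun j => by
    rw [hg]
    induction j with
    | zero => exact hh
    | succ j ih => exact mem_support_run_succ.2 ⟨g j, ih, next (g j), hnext _, rfl⟩
  exact ⟨ω, h1, h3⟩

theorem mem_support_step_of_run [Finite V] [Finite F] {ω : ℕ → Round V F k}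
    (hω : ∀ s, historyOf ω s ∈ (run σ src adv s).support) (t : ℕ) :
    ω t ∈ (step σ src adv (historyOf ω t)).support := by
  obtain ⟨h', -, r, hr, he⟩ := mem_support_run_succ.1 (hω (t + 1))
  rw [historyOf, List.cons.injEq] at he
  rw [← he.1, ← he.2]
  exact hr

theorem totalFaults_historyOf (φ : Module.Dual F (Fin k → F)) (ω : ℕ → Round V F k) (T : ℕ) :
    totalFaults σ src adv φ (historyOf ω T) =
      ∑ t ∈ Finset.range T, roundFaults σ src adv φ (historyOf ω t) (ω t) := by
  induction T with
  | zero => rfl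
  | succ T ih => rw [historyOf, totalFaults, ih, Finset.sum_range_succ]

theorem windows_le_of_span_le_ker [Fintype V] [Finite F] {Δ : ℕ} {H : ℝ} (hΔ : 1 ≤ Δ) (hH : 0 < H)
    (hV : 2 ≤ Fintype.card V) (hsrc : ∀ i : Fin k, ∃ v : V, i ∈ src v)
    (hG : GuaranteesIsoperimetry σ src adv Δ H) {φ : Module.Dual F (Fin k → F)} (hφ : φ ≠ 0)
    {T : ℕ} {h : History V F k} (hh : h ∈ (run σ src adv T).support) {v : V}
    (hv : Submodule.span F (ownPackets F (src v) ∪ received adv h v) ≤ LinearMap.ker φ) :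
    ((T / Δ : ℕ) : ℝ) ≤ 16 * (max 1 (Real.log (Fintype.card V * H)) / H) +
      5 * (totalFaults σ src adv φ h : ℝ) := by
  obtain ⟨ω, rfl, hω⟩ := exists_run_of_mem_support hh
  rw [totalFaults_historyOf]
  have hupd := fun t => mem_updateSet_of_mem_support_step (mem_support_step_of_run hω t)
  refine windows_le_of_forall_ne_univ hΔ hH (hG ω hω) hV
    (S := fun t => awareSet φ src (historyOf ω t))
    (fun t => awareSet_nonempty hφ hsrc _)
    (fun t => ncard_awareSet_le φ (hupd t))
    (fun t h0 => closedNbhd_awareSet_subset φ (hupd t) h0) fun t ht huniv => ?_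
  -- If all nodes were aware at some `t ≤ T`, so would be `v`; but its active span at time `t` lies
  -- in the span of its own packets and of those received by time `T`, which `φ` kills.
  have hmem : v ∈ awareSet φ src (historyOf ω t) := by rw [huniv]; trivial
  refine hmem (le_trans ?_ hv)
  rw [activeSpan, Submodule.span_le, Set.insert_subset_iff]
  constructor
  · exact Submodule.span_mono ((received_historyOf_mono adv ω v ht).trans Set.subset_union_right)
      (memory_mem_span_received (hω t) v)
  · exact Set.subset_union_left.trans Submodule.subset_span

end Aware

/-! ### The failure probability -/

section Failure

variable {V F : Type*} [Field F] {k : ℕ}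

/-- As `n ≤ √q`, one has `(1 + 1 / √q) ^ n ≤ e`, and `e ^ 2 < 8`. -/
theorem one_add_pow_le_eight {n q : ℕ} (hn : n ^ 2 ≤ q) (hq : 1 ≤ q) :
    ((1 + ENNReal.ofReal √q * (q : ℝ≥0∞)⁻¹) ^ n) ^ 2 ≤ ENNReal.ofReal 8 := by
  have hq0 : (0 : ℝ) < q := by exact_mod_cast hq
  have h1 : 1 + ENNReal.ofReal √q * (q : ℝ≥0∞)⁻¹ = ENNReal.ofReal (1 + √q / q) := by
    rw [ENNReal.ofReal_add zero_le_one (by positivity), ENNReal.ofReal_one,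
      ENNReal.ofReal_div_of_pos hq0, ENNReal.ofReal_natCast, div_eq_mul_inv]
  rw [h1, ← ENNReal.ofReal_pow (by positivity), ← ENNReal.ofReal_pow (by positivity)]
  refine ENNReal.ofReal_le_ofReal ?_
  have hs : 0 < √(q : ℝ) := Real.sqrt_pos.2 hq0
  have hns : (n : ℝ) ≤ √q := Real.le_sqrt_of_sq_le (by exact_mod_cast hn)
  have h2 : 1 + √q / q ≤ Real.exp (√q)⁻¹ := by
    have : √(q : ℝ) / q = (√q)⁻¹ := by rw [Real.sqrt_div_self', one_div]
    rw [this, add_comm]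
    exact Real.add_one_le_exp _
  have h3 : (1 + √q / q) ^ n ≤ Real.exp 1 := by
    calc (1 + √q / q) ^ n ≤ Real.exp (√q)⁻¹ ^ n := by gcongr
      _ = Real.exp (n * (√q)⁻¹) := (Real.exp_nat_mul _ _).symm
      _ ≤ Real.exp 1 := by
        gcongr
        rw [← div_eq_mul_inv, div_le_one hs]
        exact hns
  have h4 : (0 : ℝ) ≤ (1 + √q / q) ^ n := by positivity
  have h5 := Real.exp_one_lt_d9
  nlinarith

/-- Markov's inequality with base `√q`: each fault still gains a power of `q`, while a round costs
only a constant factor. -/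
theorem toOuterMeasure_le_of_le_totalFaults [Fintype V] [Fintype F] (σ : Scheme)
    (src : V → Set (Fin k)) (adv : Adversary V F k) (φ : Module.Dual F (Fin k → F)) (T m : ℕ)
    (hV : Fintype.card V ^ 2 ≤ Fintype.card F) (E : Set (History V F k))
    (hE : ∀ h ∈ (run σ src adv T).support, h ∈ E → m ≤ totalFaults σ src adv φ h) :
    (run σ src adv T).toOuterMeasure E ≤
      ENNReal.ofReal (8 ^ T / √(Fintype.card F) ^ m) := by
  have hq : 1 ≤ Fintype.card F := Fintype.card_pos
  have hs1 : 1 ≤ √(Fintype.card F : ℝ) := Real.one_le_sqrt.2 (by exact_mod_cast hq)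
  have hs0 : 0 < √(Fintype.card F : ℝ) ^ m := by positivity
  have hl : (1 : ℝ≥0∞) ≤ ENNReal.ofReal √(Fintype.card F) := by
    rw [← ENNReal.ofReal_one]; exact ENNReal.ofReal_le_ofReal hs1
  have h1 := mul_toOuterMeasure_le_expect (run σ src adv T)
    (fun h => ENNReal.ofReal √(Fintype.card F) ^ totalFaults σ src adv φ h) E
    (ENNReal.ofReal √(Fintype.card F) ^ m) fun h hh hhE => pow_le_pow_right₀ hl (hE h hh hhE)
  have h2 := h1.trans (expect_pow_totalFaults_le σ src adv φ _ T)
  have h3 := h2.trans (pow_le_pow_left' (one_add_pow_le_eight hV hq) T)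
  rw [← ENNReal.ofReal_pow (by norm_num), ← ENNReal.ofReal_pow (by positivity)] at h3
  rw [ENNReal.ofReal_div_of_pos hs0, ENNReal.le_div_iff_mul_le
    (Or.inl (ENNReal.ofReal_pos.2 hs0).ne') (Or.inl ENNReal.ofReal_ne_top), mul_comm]
  exact h3

theorem exists_dual_of_not_canDecode {src : V → Set (Fin k)} {adv : Adversary V F k}
    {h : History V F k} {v : V} (hv : ¬ CanDecode src adv h v) :
    ∃ φ : Module.Dual F (Fin k → F), φ ≠ 0 ∧
      Submodule.span F (ownPackets F (src v) ∪ received adv h v) ≤ LinearMap.ker φ :=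
  Submodule.exists_le_ker_of_lt_top _ (lt_top_iff_ne_top.2 hv)

theorem toOuterMeasure_not_decode_le [Fintype V] [Fintype F] (σ : Scheme)
    (src : V → Set (Fin k)) (adv : Adversary V F k) (T m : ℕ)
    (hV : Fintype.card V ^ 2 ≤ Fintype.card F)
    (hm : ∀ φ : Module.Dual F (Fin k → F), φ ≠ 0 → ∀ h ∈ (run σ src adv T).support, ∀ v,
      Submodule.span F (ownPackets F (src v) ∪ received adv h v) ≤ LinearMap.ker φ →
        m ≤ totalFaults σ src adv φ h) :
    (run σ src adv T).toOuterMeasure {h | ∀ v, CanDecode src adv h v}ᶜ ≤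
      ENNReal.ofReal ((Fintype.card F : ℝ) ^ k * (8 ^ T / √(Fintype.card F) ^ m)) := by
  classical
  have : Finite (Module.Dual F (Fin k → F)) := Module.finite_of_finite F
  have := Fintype.ofFinite (Module.Dual F (Fin k → F))
  have hcard : Fintype.card (Module.Dual F (Fin k → F)) = Fintype.card F ^ k := by
    rw [Module.card_eq_pow_finrank (K := F), Subspace.dual_finrank_eq, Module.finrank_fin_fun]
  let E : Module.Dual F (Fin k → F) → Set (History V F k) := fun φ =>
    {h | φ ≠ 0 ∧ ∃ v, Submodule.span F (ownPackets F (src v) ∪ received adv h v) ≤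
      LinearMap.ker φ}
  have hsub : {h | ∀ v, CanDecode src adv h v}ᶜ ⊆ ⋃ φ, E φ := by
    intro h hh
    simp only [Set.mem_compl_iff, Set.mem_ofPred_eq, not_forall] at hh
    obtain ⟨v, hv⟩ := hh
    obtain ⟨φ, hφ, hle⟩ := exists_dual_of_not_canDecode hv
    exact Set.mem_iUnion.2 ⟨φ, hφ, v, hle⟩
  calc (run σ src adv T).toOuterMeasure {h | ∀ v, CanDecode src adv h v}ᶜ
      ≤ (run σ src adv T).toOuterMeasure (⋃ φ, E φ) := MeasureTheory.measure_mono hsub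
    _ ≤ ∑ φ, (run σ src adv T).toOuterMeasure (E φ) :=
        MeasureTheory.measure_iUnion_fintype_le _ _
    _ ≤ ∑ _φ : Module.Dual F (Fin k → F),
          ENNReal.ofReal (8 ^ T / √(Fintype.card F) ^ m) :=
        Finset.sum_le_sum fun φ _ => toOuterMeasure_le_of_le_totalFaults σ src adv φ T m hV _
          fun h hh hE => by
            obtain ⟨hφ, v, hv⟩ := hE
            exact hm φ hφ h hh v hv
    _ = _ := by
        rw [Finset.sum_const, Finset.card_univ, hcard, nsmul_eq_mul,
          ENNReal.ofReal_mul (by positivity), ← Nat.cast_pow,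
          ENNReal.ofReal_natCast]

/-- A single node holds every message from the start. This case is separate because isoperimetry
then says nothing about `H`. -/
theorem canDecode_of_card_le_one [Fintype V] (hV : Fintype.card V ≤ 1) {src : V → Set (Fin k)}
    (hsrc : ∀ i : Fin k, ∃ v : V, i ∈ src v) (adv : Adversary V F k) (h : History V F k) (v : V) :
    CanDecode src adv h v := by
  have : Subsingleton V := Fintype.card_le_one_iff_subsingleton.1 hV
  rw [CanDecode, eq_top_iff, ← (Pi.basisFun F (Fin k)).span_eq, Submodule.span_le]
  rintro _ ⟨i, rfl⟩
  obtain ⟨w, hw⟩ := hsrc i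
  rw [Subsingleton.elim w v] at hw
  exact Submodule.subset_span (Or.inl ⟨i, hw, by simp⟩)

theorem failure_bound_le {q B : ℝ} {k T m D : ℕ} (hq : 8 ^ D ≤ q) (hB : 0 ≤ B) (hk : (k : ℝ) ≤ B)
    (hT : (T : ℝ) ≤ D * B) (hm : 16 * B ≤ m) :
    q ^ k * (8 ^ T / √q ^ m) ≤ q ^ (-B) := by
  have hq1 : 1 ≤ q := le_trans (one_le_pow₀ (by norm_num)) hq
  have hq0 : 0 < q := by linarith
  have h1 : q ^ k ≤ q ^ B := by
    rw [← Real.rpow_natCast]; exact Real.rpow_le_rpow_of_exponent_le hq1 hk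
  have h2 : (8 : ℝ) ^ T ≤ q ^ B := by
    calc (8 : ℝ) ^ T = (8 : ℝ) ^ (T : ℝ) := (Real.rpow_natCast _ _).symm
      _ ≤ (8 : ℝ) ^ ((D : ℝ) * B) := Real.rpow_le_rpow_of_exponent_le (by norm_num) hT
      _ = ((8 : ℝ) ^ D) ^ B := by rw [Real.rpow_mul (by norm_num), Real.rpow_natCast]
      _ ≤ q ^ B := Real.rpow_le_rpow (by positivity) hq hB
  have h3 : q ^ (8 * B) ≤ √q ^ m := by
    rw [Real.sqrt_eq_rpow, ← Real.rpow_natCast, ← Real.rpow_mul hq0.le]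
    exact Real.rpow_le_rpow_of_exponent_le hq1 (by linarith)
  -- Balance of exponents: `B` for the union bound, `B` for the moment factors and `-8 * B` for the
  -- faults, in total `-6 * B`.
  calc q ^ k * (8 ^ T / √q ^ m) ≤ q ^ B * (q ^ B / q ^ (8 * B)) := by gcongr
    _ = q ^ (B + (B - 8 * B)) := by rw [← Real.rpow_sub hq0, ← Real.rpow_add hq0]
    _ ≤ q ^ (-B) := Real.rpow_le_rpow_of_exponent_le hq1 (by linarith)

end Failure

end FMRLNC

/-! ### The main theorem -/

theorem mainTheorem2 (Δ : ℕ) (hΔ : 1 ≤ Δ) :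
    ∃ (C : ℝ) (q₀ : ℕ), 0 < C ∧
      ∀ (V : Type*) [Fintype V] (F : Type*) [Field F] [Fintype F] (k : ℕ)
        (σ : FMRLNC.Scheme) (src : V → Set (Fin k)) (adv : FMRLNC.Adversary V F k) (H : ℝ),
        q₀ ≤ Fintype.card F →
        Fintype.card V ^ 2 ≤ Fintype.card F →
        (∀ i : Fin k, ∃ v : V, i ∈ src v) →
        0 < H →
        FMRLNC.GuaranteesIsoperimetry σ src adv Δ H →
        1 - (Fintype.card F : ℝ) ^
              (-(max 1 (Real.log ((Fintype.card V : ℝ) * H)) / H + (k : ℝ))) ≤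
          FMRLNC.prob
            (FMRLNC.run σ src adv
              ⌊C * (max 1 (Real.log ((Fintype.card V : ℝ) * H)) / H + (k : ℝ))⌋₊)
            {h | ∀ v : V, FMRLNC.CanDecode src adv h v} := by
  have hΔ' : (1 : ℝ) ≤ Δ := by exact_mod_cast hΔ
  -- About `100 * B` windows force `(100 * B - 2 - 16 * L) / 5` faults, which is at least `16 * B`
  -- because `L ≤ B` and `B ≥ 1 / 2`. The bound on `q` gives `8 ^ T ≤ q ^ B`.
  refine ⟨100 * Δ, 8 ^ (100 * Δ), by positivity, ?_⟩
  intro V _ F _ _ k σ src adv H hq hV hsrc hH hG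
  set L : ℝ := max 1 (Real.log ((Fintype.card V : ℝ) * H)) / H with hL
  set B : ℝ := L + k with hB
  refine FMRLNC.one_sub_le_prob _ _ (by positivity) ?_
  rcases Nat.lt_or_ge (Fintype.card V) 2 with hn | hn
  · have : {h | ∀ v : V, FMRLNC.CanDecode src adv h v}ᶜ = ∅ := by
      rw [Set.compl_empty_iff, Set.eq_univ_iff_forall]
      exact fun h v => FMRLNC.canDecode_of_card_le_one (by omega) hsrc adv h v
    rw [this]
    simp
  -- At least one possible run exists, so the guarantee yields `H ≤ 2`. The resulting lower bound on
  -- `B` absorbs the rounding loss in the number of windows.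
  have hL0 : 1 / 2 ≤ L := by
    obtain ⟨ω, -, hω⟩ := FMRLNC.exists_run_of_mem_support (σ := σ) (src := src) (adv := adv)
      (t := 0) (h := []) (by simp [FMRLNC.run])
    have hH2 := (hG ω hω).le_two hΔ hH hn
    rw [hL, div_le_div_iff₀ two_pos hH, one_mul]
    have := le_max_left (1 : ℝ) (Real.log ((Fintype.card V : ℝ) * H))
    linarith
  have hk : (0 : ℝ) ≤ k := Nat.cast_nonneg k
  set T : ℕ := ⌊100 * (Δ : ℝ) * B⌋₊ with hT
  have hTle : (T : ℝ) ≤ 100 * Δ * B := Nat.floor_le (by positivity)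
  have hTlt : 100 * Δ * B < T + 1 := Nat.lt_floor_add_one _
  have hW : 100 * B - 2 ≤ ((T / Δ : ℕ) : ℝ) := by
    have h1 : (T : ℝ) + 1 ≤ Δ * (((T / Δ : ℕ) : ℝ) + 1) := by
      exact_mod_cast Nat.lt_mul_div_succ T (by omega)
    have h2 : (Δ : ℝ) * (100 * B) < Δ * (((T / Δ : ℕ) : ℝ) + 1) := by linarith
    have h3 := lt_of_mul_lt_mul_left h2 (by positivity)
    linarith
  refine (FMRLNC.toOuterMeasure_not_decode_le σ src adv T ⌈16 * B⌉₊ hV ?_).trans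
    (ENNReal.ofReal_le_ofReal (FMRLNC.failure_bound_le (D := 100 * Δ) (by exact_mod_cast hq)
      (by linarith) (by linarith) (by push_cast; exact hTle) (Nat.le_ceil _)))
  intro φ hφ h hh v hv
  have := FMRLNC.windows_le_of_span_le_ker hΔ hH hn hsrc hG hφ hh hv
  rw [Nat.ceil_le]
  linarith
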